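/- Let $D$ be an integral domain with quotient field $K$, and let $\overline{\boldsymbol F}(D)$ be the set of all nonzero $D$-submodules of $K$. A semistar operation of $D$ is a map $\star:\overline{\boldsymbol F}(D)\to\overline{\boldsymbol F}(D)$, $E\mapsto E^\star$, such that for all $0\ne x\in K$ and $E,F\in\overline{\boldsymbol F}(D)$: $(xE)^\star=xE^\star$; $E\subseteq F$ implies $E^\star\subseteq F^\star$; $E\subseteq E^\star$ and $E^{\star\star}=E^\star$. For a semistar operation $\star$ of $D$: * the finite-type operation $\star_f$ associated to $\star$ is $E^{\star_f}=\bigcup\{F^\star : F\in\overline{\boldsymbol F}(D)\text{ finitely generated},\ F\subseteq E\}$; * a nonzero ideal $I$ of $D$ is a quasi-$\star$-ideal if $I^\star\cap D=I$, and $\mathrm{QMax}^\star(D)$ is the set of maximal elements (these are prime ideals) of the set of proper quasi-$\star$-ideals; the stable finite-type operation $\widetilde\star$ associated to $\star$ is $E^{\widetilde\star}=\bigcap\{ED_P : P\in \mathrm{QMax}^{\star_f}(D)\}$ (an empty intersection being $K$); * the operation $\blacktriangle^\star$ of $D[X]$ is defined, for a nonzero $D[X]$-submodule $A$ of $K(X)$,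 by $$A^{\blacktriangle^\star}=\bigcap\{z^{-1}\,(\boldsymbol c_D(zA))^\star[X] : 0\ne z\in (K[X]:A)\}\ \text{ if } (K[X]:A)\ne (0),\qquad A^{\blacktriangle^\star}=K(X)\ \text{ otherwise},$$ where $(K[X]:A)=\{z\in K(X): zA\subseteq K[X]\}$, $\boldsymbol c_D(B)$ is the $D$-submodule of $K$ generated by the coefficients of all the polynomials in $B\subseteq K[X]$, and $E[X]$ is the set of polynomials with all coefficients in $E$. The $v$-operation $v_D$ is given by $E^{v_D}=(D:(D:E))$ if $dE\subseteq D$ for some $0\ne d\in D$, and $E^{v_D}=K$ otherwise; here $(G:H)=\{x\in K: xH\subseteq G\}$. Put $t_D=(v_D)_f$ and $w_D=\widetilde{v_D}$, and define $v_{D[X]}$, $t_{D[X]}$, $w_{D[X]}$ in the same way for the domain $D[X]$ with quotient field $K(X)$. Then, as semistar operations of $D[X]$: 1. $(\blacktriangle^{v_D})_f=(\blacktriangle^{t_D})_f=t_{D[X]}$; 2. $\widetilde{\blacktriangle^{v_D}}=\widetilde{\blacktriangle^{w_D}}=w_{D[X]}$. -/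

import Mathlib

open Polynomial Pointwise

noncomputable section

namespace Semistar

/-! ### Nonzero submodules and semistar operations -/

/-- The set of all nonzero `D`-submodules of `K`. -/
abbrev NonzeroSubmodule (D K : Type*) [CommRing D] [Field K] [Algebra D K] : Type _ :=
  {E : Submodule D K // E ≠ ⊥}

section Basic

variable {D K : Type*} [CommRing D] [Field K] [Algebra D K]

theorem mem_smul_iff {x : K} (hx : x ≠ 0) (E : Submodule D K) (y : K) :
    y ∈ x • E ↔ x⁻¹ * y ∈ E := by
  rw [Submodule.mem_smul_pointwise_iff_exists]
  constructor
  · rintro ⟨b, hb, rfl⟩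
    rwa [smul_eq_mul, inv_mul_cancel_left₀ hx]
  · intro h
    exact ⟨_, h, by rw [smul_eq_mul, mul_inv_cancel_left₀ hx]⟩

theorem smul_ne_bot {x : K} (hx : x ≠ 0) {E : Submodule D K} (hE : E ≠ ⊥) : x • E ≠ ⊥ := by
  obtain ⟨e, he, he0⟩ := Submodule.exists_mem_ne_zero_of_ne_bot hE
  intro h
  have h1 : x * e ∈ x • E := (mem_smul_iff hx E _).2 (by rwa [inv_mul_cancel_left₀ hx])
  rw [h, Submodule.mem_bot] at h1
  exact mul_ne_zero hx he0 h1

theorem ne_bot_of_le {E F : Submodule D K} (hE : E ≠ ⊥) (h : E ≤ F) : F ≠ ⊥ :=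
  fun hF => hE (le_bot_iff.1 (hF ▸ h))

/-- The submodule `xE`, for `x ≠ 0`. -/
def NonzeroSubmodule.scale (x : K) (hx : x ≠ 0) (E : NonzeroSubmodule D K) :
    NonzeroSubmodule D K :=
  ⟨x • E.1, smul_ne_bot hx E.2⟩

end Basic

/-- A semistar operation of `D`, where `K` is the quotient field of `D`. -/
@[ext]
structure SemistarOp (D K : Type*) [CommRing D] [Field K] [Algebra D K] where
  toFun : NonzeroSubmodule D K → NonzeroSubmodule D K
  map_scale : ∀ (x : K) (hx : x ≠ 0) (E : NonzeroSubmodule D K),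
    toFun (E.scale x hx) = (toFun E).scale x hx
  mono : ∀ E F : NonzeroSubmodule D K, E.1 ≤ F.1 → (toFun E).1 ≤ (toFun F).1
  le_self : ∀ E : NonzeroSubmodule D K, E.1 ≤ (toFun E).1
  idem : ∀ E : NonzeroSubmodule D K, toFun (toFun E) = toFun E

section Operations

variable {D K : Type*} [CommRing D] [Field K] [Algebra D K]

/-- To build a semistar operation it suffices to have the inclusion `xE^⋆ ⊆ (xE)^⋆` in the first
axiom and `E^⋆⋆ ⊆ E^⋆` in the last one. -/
def SemistarOp.mk' (s : NonzeroSubmodule D K → NonzeroSubmodule D K)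
    (hscale : ∀ (x : K) (hx : x ≠ 0) (E : NonzeroSubmodule D K),
      ((s E).scale x hx).1 ≤ (s (E.scale x hx)).1)
    (hmono : ∀ E F : NonzeroSubmodule D K, E.1 ≤ F.1 → (s E).1 ≤ (s F).1)
    (hle : ∀ E : NonzeroSubmodule D K, E.1 ≤ (s E).1)
    (hidem : ∀ E : NonzeroSubmodule D K, (s (s E)).1 ≤ (s E).1) : SemistarOp D K where
  toFun := s
  map_scale x hx E := by
    refine Subtype.ext (le_antisymm ?_ (hscale x hx E))
    have h := hscale x⁻¹ (inv_ne_zero hx) (E.scale x hx)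
    have e : (E.scale x hx).scale x⁻¹ (inv_ne_zero hx) = E := by
      apply Subtype.ext
      change x⁻¹ • x • E.1 = E.1
      rw [smul_smul, inv_mul_cancel₀ hx, one_smul]
    rw [e] at h
    intro y hy
    refine (mem_smul_iff hx _ _).2 (h ?_)
    refine (mem_smul_iff (inv_ne_zero hx) _ _).2 ?_
    rwa [inv_inv, mul_inv_cancel_left₀ hx]
  mono := hmono
  le_self := hle
  idem E := Subtype.ext (le_antisymm (hidem E) (hle _))

/-! ### The finite-type operation associated to a semistar operation -/

theorem exists_fg_le (E : NonzeroSubmodule D K) (y : K) (hy : y ∈ E.1) :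
    ∃ F : NonzeroSubmodule D K, F.1.FG ∧ F.1 ≤ E.1 ∧ y ∈ F.1 := by
  obtain ⟨e, he, he0⟩ := Submodule.exists_mem_ne_zero_of_ne_bot E.2
  refine ⟨⟨Submodule.span D {e, y}, ?_⟩, Submodule.fg_span (by simp), ?_, ?_⟩
  · intro h
    have : e ∈ Submodule.span D {e, y} := Submodule.subset_span (by simp)
    rw [h] at this
    exact he0 (by simpa using this)
  · rw [Submodule.span_le]
    rintro z (rfl | rfl)
    · exact he
    · exact hy
  · exact Submodule.subset_span (by simp)

theorem exists_fg_sup (s : SemistarOp D K) {E F G : NonzeroSubmodule D K}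
    (hF : F.1.FG) (hFE : F.1 ≤ E.1) (hG : G.1.FG) (hGE : G.1 ≤ E.1) :
    ∃ H : NonzeroSubmodule D K, H.1.FG ∧ H.1 ≤ E.1 ∧
      (s.toFun F).1 ≤ (s.toFun H).1 ∧ (s.toFun G).1 ≤ (s.toFun H).1 :=
  ⟨⟨F.1 ⊔ G.1, ne_bot_of_le F.2 le_sup_left⟩, hF.sup hG, sup_le hFE hGE,
    s.mono _ _ le_sup_left, s.mono _ _ le_sup_right⟩

/-- `E^{⋆_f}`: the union of all `F^⋆`, for `F ⊆ E` nonzero and finitely generated. -/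
def finiteTypeSubmodule (s : SemistarOp D K) (E : NonzeroSubmodule D K) : Submodule D K where
  carrier := {x | ∃ F : NonzeroSubmodule D K, F.1.FG ∧ F.1 ≤ E.1 ∧ x ∈ (s.toFun F).1}
  add_mem' := by
    rintro a b ⟨F, hF, hFE, ha⟩ ⟨G, hG, hGE, hb⟩
    obtain ⟨H, hH, hHE, h1, h2⟩ := exists_fg_sup s hF hFE hG hGE
    exact ⟨H, hH, hHE, add_mem (h1 ha) (h2 hb)⟩
  zero_mem' := by
    obtain ⟨F, hF, hFE, -⟩ := exists_fg_le E 0 (zero_mem _)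
    exact ⟨F, hF, hFE, zero_mem _⟩
  smul_mem' := by
    rintro c x ⟨F, hF, hFE, hx⟩
    exact ⟨F, hF, hFE, Submodule.smul_mem _ c hx⟩

theorem le_finiteTypeSubmodule (s : SemistarOp D K) (E : NonzeroSubmodule D K) :
    E.1 ≤ finiteTypeSubmodule s E := by
  intro y hy
  obtain ⟨F, hF, hFE, hyF⟩ := exists_fg_le E y hy
  exact ⟨F, hF, hFE, s.le_self _ hyF⟩

theorem exists_fg_of_le_finiteTypeSubmodule (s : SemistarOp D K) (E : NonzeroSubmodule D K)
    (G : Submodule D K) (hG : G.FG) (h : G ≤ finiteTypeSubmodule s E) :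
    ∃ H : NonzeroSubmodule D K, H.1.FG ∧ H.1 ≤ E.1 ∧ G ≤ (s.toFun H).1 := by
  classical
  obtain ⟨S, rfl⟩ := hG
  induction S using Finset.induction_on with
  | empty =>
    obtain ⟨F, hF, hFE, -⟩ := exists_fg_le E 0 (zero_mem _)
    exact ⟨F, hF, hFE, by simp⟩
  | insert a S _ ih =>
    rw [Submodule.span_le, Finset.coe_insert, Set.insert_subset_iff] at h
    obtain ⟨⟨F, hF, hFE, ha⟩, h2⟩ := h
    obtain ⟨G, hG, hGE, hS⟩ := ih (Submodule.span_le.2 h2)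
    obtain ⟨H, hH, hHE, h3, h4⟩ := exists_fg_sup s hF hFE hG hGE
    refine ⟨H, hH, hHE, ?_⟩
    rw [Submodule.span_le, Finset.coe_insert, Set.insert_subset_iff]
    exact ⟨h3 ha, fun y hy => h4 (hS (Submodule.subset_span hy))⟩

/-- The semistar operation of finite type `⋆_f` associated to `⋆`. -/
def SemistarOp.finiteType (s : SemistarOp D K) : SemistarOp D K :=
  SemistarOp.mk'
    (fun E => ⟨finiteTypeSubmodule s E, ne_bot_of_le E.2 (le_finiteTypeSubmodule s E)⟩)
    (by
      intro x hx E y hy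
      obtain ⟨F, hF, hFE, h⟩ := (mem_smul_iff hx _ _).1 hy
      refine ⟨F.scale x hx, hF.map _, fun z hz => ?_, ?_⟩
      · exact (mem_smul_iff hx _ _).2 (hFE ((mem_smul_iff hx _ _).1 hz))
      · rw [s.map_scale]
        exact (mem_smul_iff hx _ _).2 h)
    (by
      rintro E F hEF y ⟨G, hG, hGE, h⟩
      exact ⟨G, hG, hGE.trans hEF, h⟩)
    (le_finiteTypeSubmodule s)
    (by
      rintro E y ⟨G, hG, hGE, h⟩
      obtain ⟨H, hH, hHE, hGH⟩ := exists_fg_of_le_finiteTypeSubmodule s E G.1 hG hGE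
      refine ⟨H, hH, hHE, ?_⟩
      have := s.mono G (s.toFun H) hGH h
      rwa [s.idem] at this)

/-! ### Spectral operations and the stable finite-type operation associated to an operation -/

/-- The localization `D_P`, as a `D`-submodule of `K`: all fractions `a / b` with `a ∈ D` and
`b ∈ D \ P`. -/
def localizationAt [IsDomain D] [IsFractionRing D K] (P : PrimeSpectrum D) : Submodule D K :=
  Subalgebra.toSubmodule (Localization.subalgebra.ofField K P.asIdeal.primeCompl
    P.asIdeal.primeCompl_le_nonZeroDivisors)

/-- The spectral semistar operation associated to a set `Δ` of prime ideals: `E` is sent to the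
intersection of all `E D_P` with `P ∈ Δ` (this is `K` when `Δ` is empty). -/
def spectralOp (D K : Type*) [CommRing D] [Field K] [Algebra D K] [IsDomain D]
    [IsFractionRing D K] (Δ : Set (PrimeSpectrum D)) : SemistarOp D K :=
  have one_le (P : PrimeSpectrum D) : (1 : Submodule D K) ≤ localizationAt P :=
    Submodule.one_le.2 (one_mem (Localization.subalgebra.ofField K P.asIdeal.primeCompl
      P.asIdeal.primeCompl_le_nonZeroDivisors))
  have le_inf (E : NonzeroSubmodule D K) :
      E.1 ≤ ⨅ P ∈ Δ, E.1 * (localizationAt P : Submodule D K) :=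
    le_iInf₂ fun P _ => by
      simpa using mul_le_mul' (le_refl E.1) (one_le P)
  SemistarOp.mk'
    (fun E => ⟨⨅ P ∈ Δ, E.1 * (localizationAt P : Submodule D K), ne_bot_of_le E.2 (le_inf E)⟩)
    (by
      intro x hx E
      refine le_iInf₂ fun P hP y hy => ?_
      have h := (mem_smul_iff hx _ _).1 hy
      have h2 := (iInf₂_le (f := fun P (_ : P ∈ Δ) => E.1 * (localizationAt P : Submodule D K))
        P hP) h
      have h3 : E.1 * localizationAt P ≤
          Submodule.comap (LinearMap.mulLeft D x) ((x • E.1) * localizationAt P) := by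
        refine Submodule.mul_le.2 fun e he l hl => ?_
        rw [Submodule.mem_comap, LinearMap.mulLeft_apply, ← mul_assoc]
        exact Submodule.mul_mem_mul ((mem_smul_iff hx _ _).2 (by
          rwa [inv_mul_cancel_left₀ hx])) hl
      have h4 := h3 h2
      rwa [Submodule.mem_comap, LinearMap.mulLeft_apply, mul_inv_cancel_left₀ hx] at h4)
    (by
      intro E F hEF
      exact iInf₂_mono fun P _ => mul_le_mul' hEF le_rfl)
    le_inf
    (by
      intro E
      refine le_iInf₂ fun P hP => (iInf₂_le P hP).trans ?_
      refine (mul_le_mul' (iInf₂_le P hP) le_rfl).trans ?_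
      rw [mul_assoc]
      refine mul_le_mul' le_rfl (Submodule.mul_le.2 fun a ha b hb => ?_)
      exact mul_mem (S := Subalgebra D K) ha hb)

/-- A nonzero ideal, viewed as a nonzero submodule of `K`. -/
def idealToSubmodule [IsDomain D] [IsFractionRing D K] (I : Ideal D) (hI : I ≠ ⊥) :
    NonzeroSubmodule D K :=
  ⟨Submodule.map (Algebra.linearMap D K) I, fun h => hI (by
    refine (Submodule.eq_bot_iff _).2 fun a ha => ?_
    have h1 : Algebra.linearMap D K a ∈ Submodule.map (Algebra.linearMap D K) I :=
      Submodule.mem_map_of_mem ha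
    rw [h, Submodule.mem_bot] at h1
    exact IsFractionRing.injective D K (h1.trans (map_zero _).symm))⟩

/-- Quasi-`⋆`-ideals: nonzero ideals `I` of `D` such that `I^⋆ ∩ D = I`. -/
def IsQuasiIdeal [IsDomain D] [IsFractionRing D K] (s : SemistarOp D K) (I : Ideal D) : Prop :=
  ∃ hI : I ≠ ⊥,
    Submodule.comap (Algebra.linearMap D K) (s.toFun (idealToSubmodule I hI)).1 = I

/-- `QMax^⋆(D)`: the (prime) ideals that are maximal among the proper quasi-`⋆`-ideals. -/
def quasiMax [IsDomain D] [IsFractionRing D K] (s : SemistarOp D K) : Set (PrimeSpectrum D) :=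
  {P | Maximal (fun I : Ideal D => IsQuasiIdeal s I ∧ I ≠ ⊤) P.asIdeal}

/-- The stable semistar operation of finite type associated to `⋆`, that is, the spectral
operation associated to the set of quasi-`⋆_f`-maximal ideals. -/
def SemistarOp.stableFiniteType [IsDomain D] [IsFractionRing D K] (s : SemistarOp D K) :
    SemistarOp D K :=
  spectralOp D K (quasiMax s.finiteType)

end Operations

/-! ### The operations `v`, `t` and `w` -/

section VTW

variable (D K : Type*) [CommRing D] [Field K] [Algebra D K]

open Classical in
/-- `E^v`: this is `(D : (D : E))` if `E` is a fractional ideal, and `K` otherwise.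
Here `1` is `D`, as a submodule of `K`, and `E / F` is `(E : F) = {x ∈ K | xF ⊆ E}`. -/
def vSubmodule (E : NonzeroSubmodule D K) : Submodule D K :=
  if IsFractional (nonZeroDivisors D) E.1 then 1 / (1 / E.1) else ⊤

variable [IsDomain D] [IsFractionRing D K]

/-- The `v`-semistar operation. -/
def vOp : SemistarOp D K :=
  have le_dd (E : Submodule D K) : E ≤ 1 / (1 / E) :=
    Submodule.le_div_iff_mul_le.2 (by
      rw [mul_comm]; exact Submodule.le_div_iff_mul_le.1 le_rfl)
  have anti {E F : Submodule D K} (h : E ≤ F) : (1 : Submodule D K) / F ≤ 1 / E :=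
    fun _ hx => Submodule.mem_div_iff_forall_mul_mem.2 fun y hy =>
      Submodule.mem_div_iff_forall_mul_mem.1 hx y (h hy)
  have le_v (E : NonzeroSubmodule D K) : E.1 ≤ vSubmodule D K E := by
    unfold vSubmodule
    split_ifs
    · exact le_dd _
    · exact le_top
  SemistarOp.mk'
    (fun E => ⟨vSubmodule D K E, ne_bot_of_le E.2 (le_v E)⟩)
    (by
      intro x hx E y hy
      have h := (mem_smul_iff hx _ _).1 hy
      change x⁻¹ * y ∈ vSubmodule D K E at h
      change y ∈ vSubmodule D K (E.scale x hx)
      unfold vSubmodule at h ⊢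
      split_ifs with h1
      · have h2 : IsFractional (nonZeroDivisors D) E.1 := by
          obtain ⟨a, ha, h3⟩ := h1
          obtain ⟨p, q, hq, e⟩ := IsFractionRing.div_surjective D x
          have hq0 : algebraMap D K q ≠ 0 := IsFractionRing.to_map_ne_zero_of_mem_nonZeroDivisors hq
          have hp0 : p ≠ 0 := by
            rintro rfl
            exact hx (by rw [← e, map_zero, zero_div])
          refine ⟨a * p, mul_mem ha (mem_nonZeroDivisors_of_ne_zero hp0), fun b hb => ?_⟩
          obtain ⟨c, hc⟩ := h3 (x * b)
            ((mem_smul_iff hx _ _).2 (by rwa [inv_mul_cancel_left₀ hx]))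
          refine ⟨q * c, ?_⟩
          rw [map_mul, hc, Algebra.smul_def, Algebra.smul_def, map_mul, ← e]
          field_simp
        rw [if_pos h2] at h
        rw [Submodule.mem_div_iff_forall_mul_mem] at h ⊢
        intro z hz
        have := h (x * z) (Submodule.mem_div_iff_forall_mul_mem.2 fun e he => by
          have := Submodule.mem_div_iff_forall_mul_mem.1 hz (x * e)
            ((mem_smul_iff hx _ _).2 (by rwa [inv_mul_cancel_left₀ hx]))
          rwa [show x * z * e = z * (x * e) by ring])
        rwa [show x⁻¹ * y * (x * z) = y * z by field_simp] at this
      · trivial)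
    (by
      intro E F hEF
      change vSubmodule D K E ≤ vSubmodule D K F
      unfold vSubmodule
      by_cases hF : IsFractional (nonZeroDivisors D) F.1
      · have hE : IsFractional (nonZeroDivisors D) E.1 := by
          obtain ⟨a, ha, h⟩ := hF
          exact ⟨a, ha, fun b hb => h b (hEF hb)⟩
        rw [if_pos hE, if_pos hF]
        exact anti (anti hEF)
      · rw [if_neg hF]
        exact le_top)
    le_v
    (by
      intro E
      change vSubmodule D K ⟨vSubmodule D K E, _⟩ ≤ vSubmodule D K E
      by_cases hE : IsFractional (nonZeroDivisors D) E.1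
      · have e : vSubmodule D K E = 1 / (1 / E.1) := if_pos hE
        have hE2 : IsFractional (nonZeroDivisors D) (vSubmodule D K E) := by
          obtain ⟨a, ha, h⟩ := hE
          refine ⟨a, ha, fun b hb => ?_⟩
          rw [e, Submodule.mem_div_iff_forall_mul_mem] at hb
          have h1 := hb (algebraMap D K a) (Submodule.mem_div_iff_forall_mul_mem.2 fun y hy => by
            obtain ⟨c, hc⟩ := h y hy
            exact Submodule.mem_one.2 ⟨c, by rw [hc, Algebra.smul_def]⟩)
          obtain ⟨c, hc⟩ := Submodule.mem_one.1 h1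
          exact ⟨c, by rw [hc, Algebra.smul_def, mul_comm]⟩
        have e2 : vSubmodule D K ⟨vSubmodule D K E, ne_bot_of_le E.2 (le_v E)⟩ =
            1 / (1 / vSubmodule D K E) := if_pos hE2
        refine e2.le.trans ?_
        rw [e]
        exact anti (le_dd _)
      · have e : vSubmodule D K E = ⊤ := if_neg hE
        exact le_top.trans e.ge)

/-- The `t`-semistar operation. -/
def tOp : SemistarOp D K := (vOp D K).finiteType

/-- The `w`-semistar operation. -/
def wOp : SemistarOp D K := (vOp D K).stableFiniteType

end VTW

/-! ### Polynomial rings -/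

/-- The quotient field `K(X)` of `D[X]`, as a `D[X]`-algebra. -/
instance (priority := low) polynomialAlgebraRatFunc (D K : Type*) [CommRing D] [Field K]
    [Algebra D K] : Algebra D[X] (RatFunc K) :=
  ((algebraMap K[X] (RatFunc K)).comp (mapRingHom (algebraMap D K))).toAlgebra

section Poly

variable (D K : Type*) [CommRing D] [Field K] [Algebra D K]

theorem algebraMap_polynomial_ratFunc (p : D[X]) :
    algebraMap D[X] (RatFunc K) p = algebraMap K[X] (RatFunc K) (p.map (algebraMap D K)) :=
  rfl

instance isFractionRing_polynomial_ratFunc [IsDomain D] [IsFractionRing D K] :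
    IsFractionRing D[X] (RatFunc K) := by
  have inj : Function.Injective (algebraMap D[X] (RatFunc K)) :=
    (RatFunc.algebraMap_injective K).comp
      (Polynomial.map_injective _ (IsFractionRing.injective D K))
  have : FaithfulSMul D[X] (RatFunc K) := (faithfulSMul_iff_algebraMap_injective _ _).2 inj
  have clear (f : K[X]) : ∃ (p : D[X]) (b : D), b ≠ 0 ∧
      algebraMap D[X] (RatFunc K) p =
        algebraMap D[X] (RatFunc K) (C b) * algebraMap K[X] (RatFunc K) f := by
    obtain ⟨b, hb, h⟩ := IsLocalization.integerNormalization_spec (nonZeroDivisors D) f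
    refine ⟨IsLocalization.integerNormalization (nonZeroDivisors D) f, b,
      nonZeroDivisors.ne_zero hb, ?_⟩
    rw [algebraMap_polynomial_ratFunc, algebraMap_polynomial_ratFunc, h, ← map_mul, map_C,
      ← smul_eq_C_mul, algebraMap_smul]
  refine IsFractionRing.of_field _ _ fun z => ?_
  obtain ⟨f, g, hg, rfl⟩ := IsFractionRing.div_surjective K[X] z
  obtain ⟨p, b, hb, hp⟩ := clear f
  obtain ⟨q, c, hc, hq⟩ := clear g
  have hb' : algebraMap D[X] (RatFunc K) (C b) ≠ 0 := fun h =>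
    hb (C_eq_zero.1 (inj (h.trans (map_zero _).symm)))
  have hc' : algebraMap D[X] (RatFunc K) (C c) ≠ 0 := fun h =>
    hc (C_eq_zero.1 (inj (h.trans (map_zero _).symm)))
  refine ⟨C c * p, C b * q, ?_⟩
  rw [map_mul, map_mul, hp, hq]
  have hg' : algebraMap K[X] (RatFunc K) g ≠ 0 :=
    IsFractionRing.to_map_ne_zero_of_mem_nonZeroDivisors hg
  field_simp

variable {D K}

/-- `E[X]`, for a submodule `E` of `K`: the polynomials all of whose coefficients lie in `E`, as a
`D[X]`-submodule of `K(X)`. -/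
def polyExt (E : Submodule D K) : Submodule D[X] (RatFunc K) where
  carrier := {a | ∃ f : K[X], (∀ n, f.coeff n ∈ E) ∧ algebraMap K[X] (RatFunc K) f = a}
  add_mem' := by
    rintro _ _ ⟨f, hf, rfl⟩ ⟨g, hg, rfl⟩
    exact ⟨f + g, fun n => by rw [coeff_add]; exact add_mem (hf n) (hg n), map_add _ _ _⟩
  zero_mem' := ⟨0, fun n => by simp, map_zero _⟩
  smul_mem' := by
    rintro p _ ⟨f, hf, rfl⟩
    refine ⟨p.map (algebraMap D K) * f, fun n => ?_, ?_⟩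
    · rw [coeff_mul]
      refine sum_mem fun i _ => ?_
      rw [coeff_map, ← Algebra.smul_def]
      exact E.smul_mem _ (hf _)
    · rw [Algebra.smul_def, map_mul, algebraMap_polynomial_ratFunc]

/-- `(K[X] : A)`, the set of all `z ∈ K(X)` with `zA ⊆ K[X]`. -/
def polyColon (A : Submodule D[X] (RatFunc K)) : Set (RatFunc K) :=
  {z | ∀ a ∈ A, ∃ f : K[X], algebraMap K[X] (RatFunc K) f = z * a}

/-- The content `c_D(f)` of `f ∈ K[X]`: the `D`-submodule of `K` generated by the coefficients. -/
def polyContent (D : Type*) {K : Type*} [CommRing D] [Field K] [Algebra D K] (f : K[X]) :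
    Submodule D K :=
  Submodule.span D (Set.range f.coeff)

/-- The content `c_D(A)`, for `A ⊆ K[X]`: the sum of all `c_D(f)`, for `f ∈ A`. -/
def content (A : Submodule D[X] (RatFunc K)) : Submodule D K :=
  ⨆ (f : K[X]) (_ : algebraMap K[X] (RatFunc K) f ∈ A), polyContent D f

theorem coeff_mem_content {A : Submodule D[X] (RatFunc K)} {f : K[X]}
    (hf : algebraMap K[X] (RatFunc K) f ∈ A) (n : ℕ) : f.coeff n ∈ content A :=
  (le_iSup₂_of_le (f := fun (f : K[X]) (_ : algebraMap K[X] (RatFunc K) f ∈ A) =>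
    polyContent D f) f hf le_rfl) (Submodule.subset_span ⟨n, rfl⟩)

theorem content_le {A : Submodule D[X] (RatFunc K)} {E : Submodule D K}
    (h : ∀ f : K[X], algebraMap K[X] (RatFunc K) f ∈ A → ∀ n, f.coeff n ∈ E) : content A ≤ E :=
  iSup₂_le fun f hf => Submodule.span_le.2 (by rintro _ ⟨n, rfl⟩; exact h f hf n)

/-- `c_D(zA)`, for `z ≠ 0` such that `zA ⊆ K[X]`. -/
def scaledContent (A : NonzeroSubmodule D[X] (RatFunc K)) (z : RatFunc K)
    (hz : z ≠ 0) (hzA : z ∈ polyColon A.1) : NonzeroSubmodule D K :=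
  ⟨content (A.scale z hz).1, by
    obtain ⟨a, ha, ha0⟩ := Submodule.exists_mem_ne_zero_of_ne_bot A.2
    obtain ⟨f, hf⟩ := hzA a ha
    have hf0 : f ≠ 0 := by
      rintro rfl
      rw [map_zero] at hf
      exact mul_ne_zero hz ha0 hf.symm
    obtain ⟨n, hn⟩ : ∃ n, f.coeff n ≠ 0 := by
      by_contra! h
      exact hf0 (Polynomial.ext (by simpa using h))
    intro h
    have h2 : f.coeff n ∈ content (A.scale z hz).1 := by
      refine coeff_mem_content ((mem_smul_iff hz _ _).2 ?_) n
      rwa [hf, inv_mul_cancel_left₀ hz]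
    rw [h, Submodule.mem_bot] at h2
    exact hn h2⟩

/-- `A^{▲^⋆}`: the intersection of all `z⁻¹ (c_D(zA))^⋆[X]`, for `0 ≠ z ∈ (K[X] : A)`, if
`(K[X] : A) ≠ 0`, and `K(X)` otherwise. -/
def blackTriangleSubmodule (s : SemistarOp D K) (A : NonzeroSubmodule D[X] (RatFunc K)) :
    Submodule D[X] (RatFunc K) :=
  open Classical in
  if ∃ z ∈ polyColon A.1, z ≠ 0 then
    ⨅ (z : RatFunc K) (hz : z ≠ 0) (hzA : z ∈ polyColon A.1),
      z⁻¹ • polyExt (s.toFun (scaledContent A z hz hzA)).1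
  else ⊤

theorem mem_blackTriangleSubmodule (s : SemistarOp D K) (A : NonzeroSubmodule D[X] (RatFunc K))
    (y : RatFunc K) : y ∈ blackTriangleSubmodule s A ↔
      ∀ (z : RatFunc K) (hz : z ≠ 0) (hzA : z ∈ polyColon A.1),
        z * y ∈ polyExt (s.toFun (scaledContent A z hz hzA)).1 := by
  have key : (∀ (z : RatFunc K) (hz : z ≠ 0) (hzA : z ∈ polyColon A.1),
        z * y ∈ polyExt (s.toFun (scaledContent A z hz hzA)).1) ↔
      y ∈ ⨅ (z : RatFunc K) (hz : z ≠ 0) (hzA : z ∈ polyColon A.1),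
        z⁻¹ • polyExt (s.toFun (scaledContent A z hz hzA)).1 := by
    simp only [Submodule.mem_iInf]
    refine forall_congr' fun z => forall_congr' fun hz => forall_congr' fun hzA => ?_
    rw [mem_smul_iff (inv_ne_zero hz), inv_inv]
  unfold blackTriangleSubmodule
  split_ifs with h
  · exact key.symm
  · push Not at h
    exact ⟨fun _ z hz hzA => absurd (h z hzA) hz, fun _ => trivial⟩

theorem scaledContent_le {A B : NonzeroSubmodule D[X] (RatFunc K)} {z w : RatFunc K}
    (hz : z ≠ 0) (hzA : z ∈ polyColon A.1) (hw : w ≠ 0) (hwB : w ∈ polyColon B.1)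
    (h : ∀ a ∈ A.1, ∃ b ∈ B.1, z * a = w * b) :
    (scaledContent A z hz hzA).1 ≤ (scaledContent B w hw hwB).1 := by
  refine content_le fun f hf n => coeff_mem_content ?_ n
  obtain ⟨b, hb, e⟩ := h _ ((mem_smul_iff hz _ _).1 hf)
  rw [mul_inv_cancel_left₀ hz] at e
  refine (mem_smul_iff hw _ _).2 ?_
  rwa [e, inv_mul_cancel_left₀ hw]

theorem polyExt_mono {E F : Submodule D K} (h : E ≤ F) : polyExt E ≤ polyExt F := by
  rintro _ ⟨f, hf, rfl⟩
  exact ⟨f, fun n => h (hf n), rfl⟩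

theorem le_blackTriangleSubmodule (s : SemistarOp D K) (A : NonzeroSubmodule D[X] (RatFunc K)) :
    A.1 ≤ blackTriangleSubmodule s A := by
  intro a ha
  rw [mem_blackTriangleSubmodule]
  intro z hz hzA
  obtain ⟨f, hf⟩ := hzA a ha
  refine ⟨f, fun n => s.le_self _ (coeff_mem_content ((mem_smul_iff hz _ _).2 ?_) n), hf⟩
  rwa [hf, inv_mul_cancel_left₀ hz]

/-- The semistar operation `▲^⋆` of `D[X]`, the largest strict extension of `⋆`. -/
def SemistarOp.blackTriangle (s : SemistarOp D K) : SemistarOp D[X] (RatFunc K) :=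
  SemistarOp.mk'
    (fun A => ⟨blackTriangleSubmodule s A, ne_bot_of_le A.2 (le_blackTriangleSubmodule s A)⟩)
    (by
      intro x hx A y hy
      have h := (mem_blackTriangleSubmodule s A _).1 ((mem_smul_iff hx _ _).1 hy)
      refine (mem_blackTriangleSubmodule s _ y).2 fun z hz hzA => ?_
      have hzx : z * x ∈ polyColon A.1 := fun a ha => by
        rw [mul_assoc]
        exact hzA _ ((mem_smul_iff hx _ _).2 (by rwa [inv_mul_cancel_left₀ hx]))
      have h1 := h (z * x) (mul_ne_zero hz hx) hzx
      rw [show z * x * (x⁻¹ * y) = z * y by field_simp] at h1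
      refine polyExt_mono (s.mono _ _ (scaledContent_le _ _ _ _ fun a ha => ?_)) h1
      exact ⟨x * a, (mem_smul_iff hx _ _).2 (by rwa [inv_mul_cancel_left₀ hx]), mul_assoc _ _ _⟩)
    (by
      intro A B hAB y hy
      refine (mem_blackTriangleSubmodule s B y).2 fun z hz hzB => ?_
      have h1 := (mem_blackTriangleSubmodule s A y).1 hy z hz fun a ha => hzB a (hAB ha)
      refine polyExt_mono (s.mono _ _ (scaledContent_le _ _ _ _ fun a ha => ?_)) h1
      exact ⟨a, hAB ha, rfl⟩)
    (le_blackTriangleSubmodule s)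
    (by
      intro A y hy
      refine (mem_blackTriangleSubmodule s A y).2 fun z hz hzA => ?_
      have h1 := (mem_blackTriangleSubmodule s _ y).1 hy z hz (by
        intro a ha
        obtain ⟨f, -, hf⟩ := (mem_blackTriangleSubmodule s A a).1 ha z hz hzA
        exact ⟨f, hf⟩)
      refine polyExt_mono ?_ h1
      refine le_trans (s.mono _ (s.toFun (scaledContent A z hz hzA))
        (content_le fun f hf n => ?_)) (congrArg Subtype.val (s.idem _)).le
      have hf2 := (mem_smul_iff hz _ _).1 hf
      obtain ⟨g, hg, e⟩ := (mem_blackTriangleSubmodule s A _).1 hf2 z hz hzA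
      rw [mul_inv_cancel_left₀ hz] at e
      rw [← RatFunc.algebraMap_injective K e]
      exact hg n)

end Poly

end Semistar

end

/-! The operation `⋆_f` depends only on the values of `⋆` at finitely generated submodules. If `A`
is finitely generated over `D[X]`, so is each content `c(zA)` over `D`, and duality gives `A^{▲^v} =
A^v`: an `x` with `xA ⊆ D[X]` has `c(xA) ⊆ D`, and conversely an `x` in `(D : c(zA))` gives `xz` in
`(D[X] : A)`. Since `t` and `v` agree on finitely generated submodules, this settles the finite-type
equalities (`blackTriangle_vOp_of_fg`).

The operation `⋆~` depends only on the maximal quasi-`⋆_f`-ideals, so the case of `▲^v` follows at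
once. For `▲^w`, the inequality `w ≤ t` gives `(▲^w)_f ≤ t`, and the maximal quasi-ideals then agree
as soon as `1 ∈ I^t` implies `1 ∈ I^{(▲^w)_f}` (`quasiMax_eq_of_le`). Some finitely generated `J ⊆
I` has `1 ∈ J^v`. No maximal `t`-ideal `P` of `D` has `J ⊆ P[X]`, so `J` contains a `g` with a
coefficient outside `P`. Each nonzero `z` with `zJ ⊆ K[X]` is a polynomial `f`, and a local form of
Gauss's lemma gives `c(f) D_P ⊆ c(gf) D_P ⊆ c(fJ) D_P`. Intersecting over `P` puts the coefficients
of `f` in `c(fJ)^w`, which is the claim `1 ∈ J^{▲^w}` (`one_mem_blackTriangle_wOp`). -/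

namespace Semistar

/-! ### Finite-type operations and finitely generated submodules -/

section General

variable {D K : Type*} [CommRing D] [Field K] [Algebra D K]

theorem SemistarOp.finiteType_of_fg (s : SemistarOp D K) {E : NonzeroSubmodule D K}
    (hE : E.1.FG) : s.finiteType.toFun E = s.toFun E := by
  refine Subtype.ext (le_antisymm ?_ fun y hy => ⟨E, hE, le_rfl, hy⟩)
  rintro y ⟨F, -, hFE, hy⟩
  exact s.mono _ _ hFE hy

theorem SemistarOp.finiteType_le_of_fg {s s' : SemistarOp D K}
    (h : ∀ E : NonzeroSubmodule D K, E.1.FG → (s.toFun E).1 ≤ (s'.toFun E).1)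
    (E : NonzeroSubmodule D K) : (s.finiteType.toFun E).1 ≤ (s'.finiteType.toFun E).1 := by
  rintro y ⟨F, hF, hFE, hy⟩
  exact ⟨F, hF, hFE, h F hF hy⟩

theorem SemistarOp.finiteType_congr {s s' : SemistarOp D K}
    (h : ∀ E : NonzeroSubmodule D K, E.1.FG → (s.toFun E).1 = (s'.toFun E).1) :
    s.finiteType = s'.finiteType :=
  SemistarOp.ext (funext fun E => Subtype.ext (le_antisymm
    (finiteType_le_of_fg (fun F hF => (h F hF).le) E)
    (finiteType_le_of_fg (fun F hF => (h F hF).ge) E)))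

theorem SemistarOp.toFun_le_of_le (s : SemistarOp D K) {E F : NonzeroSubmodule D K}
    (h : E.1 ≤ (s.toFun F).1) : (s.toFun E).1 ≤ (s.toFun F).1 := by
  have := s.mono E (s.toFun F) h
  rwa [s.idem] at this

theorem SemistarOp.mul_mem_toFun_scale (s : SemistarOp D K) {x y : K} (hx : x ≠ 0)
    {E : NonzeroSubmodule D K} (hy : y ∈ (s.toFun E).1) :
    x * y ∈ (s.toFun (E.scale x hx)).1 := by
  rw [s.map_scale]
  exact (mem_smul_iff hx _ _).2 (by rwa [inv_mul_cancel_left₀ hx])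

end General

/-! ### Quasi-ideals, their maximal elements, and spectral operations -/

section Ideals

variable {D K : Type*} [CommRing D] [IsDomain D] [Field K] [Algebra D K] [IsFractionRing D K]

theorem algebraMap_mem_idealToSubmodule {I : Ideal D} (hI : I ≠ ⊥) {a : D} :
    algebraMap D K a ∈ (idealToSubmodule (K := K) I hI).1 ↔ a ∈ I := by
  constructor
  · rintro ⟨b, hb, e⟩
    rwa [← IsFractionRing.injective D K e]
  · exact fun h => ⟨a, h, rfl⟩

/-- The closure `I^⋆ ∩ D` of a nonzero ideal `I`. -/
def SemistarOp.idealClosure (s : SemistarOp D K) (I : Ideal D) (hI : I ≠ ⊥) : Ideal D :=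
  Submodule.comap (Algebra.linearMap D K) (s.toFun (idealToSubmodule I hI)).1

theorem SemistarOp.mem_idealClosure {s : SemistarOp D K} {I : Ideal D} {hI : I ≠ ⊥} {a : D} :
    a ∈ s.idealClosure I hI ↔ algebraMap D K a ∈ (s.toFun (idealToSubmodule I hI)).1 :=
  Iff.rfl

theorem SemistarOp.le_idealClosure (s : SemistarOp D K) (I : Ideal D) (hI : I ≠ ⊥) :
    I ≤ s.idealClosure I hI :=
  fun _ ha => s.le_self _ ((algebraMap_mem_idealToSubmodule hI).2 ha)

theorem SemistarOp.idealClosure_ne_top_iff {s : SemistarOp D K} {I : Ideal D} {hI : I ≠ ⊥} :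
    s.idealClosure I hI ≠ ⊤ ↔ (1 : K) ∉ (s.toFun (idealToSubmodule I hI)).1 := by
  rw [Ne, Ideal.eq_top_iff_one, mem_idealClosure, map_one]

theorem SemistarOp.isQuasiIdeal_idealClosure (s : SemistarOp D K) (I : Ideal D) (hI : I ≠ ⊥) :
    IsQuasiIdeal s (s.idealClosure I hI) := by
  have hne : s.idealClosure I hI ≠ ⊥ := fun h => hI (le_bot_iff.1 (h ▸ s.le_idealClosure I hI))
  refine ⟨hne, le_antisymm ?_ (s.le_idealClosure _ hne)⟩
  intro a ha
  refine s.toFun_le_of_le ?_ ha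
  rintro _ ⟨b, hb, rfl⟩
  exact hb

theorem IsQuasiIdeal.one_notMem {s : SemistarOp D K} {I : Ideal D} (h : IsQuasiIdeal s I)
    (hI : I ≠ ⊤) : (1 : K) ∉ (s.toFun (idealToSubmodule I h.1)).1 := by
  obtain ⟨h0, h1⟩ := h
  rw [← SemistarOp.idealClosure_ne_top_iff]
  rwa [SemistarOp.idealClosure, h1]

theorem isQuasiIdeal_of_le {s s' : SemistarOp D K}
    (hs : ∀ E : NonzeroSubmodule D K, (s.toFun E).1 ≤ (s'.toFun E).1) {I : Ideal D}
    (h : IsQuasiIdeal s' I) : IsQuasiIdeal s I := by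
  obtain ⟨h0, h1⟩ := h
  refine ⟨h0, le_antisymm (fun a ha => ?_) (s.le_idealClosure I h0)⟩
  rw [← h1]
  exact hs _ ha

/-- An ideal that is maximal among the proper quasi-`⋆`-ideals is prime. -/
theorem isPrime_of_maximal_isQuasiIdeal {s : SemistarOp D K} {P : Ideal D}
    (h : Maximal (fun I : Ideal D => IsQuasiIdeal s I ∧ I ≠ ⊤) P) : P.IsPrime := by
  obtain ⟨⟨⟨h0, hP⟩, hP1⟩, hmax⟩ := h
  refine ⟨hP1, fun {a b} hab => ?_⟩
  by_contra! hc
  obtain ⟨ha, hb⟩ := hc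
  have hle : P ≤ P ⊔ Ideal.span {a} := le_sup_left
  have hJ : P ⊔ Ideal.span {a} ≠ ⊥ := fun h => h0 (le_bot_iff.1 (h ▸ hle))
  have haJ : a ∈ P ⊔ Ideal.span {a} :=
    (le_sup_right : Ideal.span {a} ≤ _) (Ideal.mem_span_singleton_self a)
  -- By maximality of `P`, the closure of `P + aD` contains `1`. Multiplying by `b` then gives `b ∈
  -- (bP + abD)^⋆ ⊆ P^⋆`, so `b ∈ P`.
  have h1 : (1 : K) ∈ (s.toFun (idealToSubmodule _ hJ)).1 := by
    by_contra hn
    refine ha (hmax ⟨s.isQuasiIdeal_idealClosure _ hJ, SemistarOp.idealClosure_ne_top_iff.2 hn⟩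
      (hle.trans (s.le_idealClosure _ hJ)) (s.le_idealClosure _ hJ haJ))
  have hb0 : algebraMap D K b ≠ 0 := fun h =>
    hb (by rw [(map_eq_zero_iff _ (IsFractionRing.injective D K)).1 h]; exact zero_mem _)
  have h2 := s.mul_mem_toFun_scale hb0 h1
  rw [mul_one] at h2
  refine hb ?_
  rw [← hP]
  refine s.mono _ _ (fun y hy => ?_) h2
  obtain ⟨c, hc, e⟩ := (mem_smul_iff hb0 _ _).1 hy
  have e' : y = algebraMap D K (b * c) := by
    rw [map_mul, ← Algebra.linearMap_apply (R := D) (A := K) c, e, mul_inv_cancel_left₀ hb0]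
  rw [e', algebraMap_mem_idealToSubmodule]
  obtain ⟨p, hp, q, hq, rfl⟩ := Submodule.mem_sup.1 hc
  obtain ⟨r, rfl⟩ := Ideal.mem_span_singleton'.1 hq
  rw [mul_add]
  refine add_mem (P.mul_mem_left _ hp) ?_
  rw [show b * (r * a) = r * (a * b) by ring]
  exact P.mul_mem_left _ hab

/-- Every proper quasi-`⋆`-ideal is contained in a maximal one, when `⋆` is of finite type. -/
theorem exists_quasiMax_ge (s : SemistarOp D K) {I : Ideal D}
    (hI : IsQuasiIdeal s.finiteType I) (hI1 : I ≠ ⊤) :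
    ∃ P ∈ quasiMax s.finiteType, I ≤ P.asIdeal := by
  obtain ⟨P, hIP, hP⟩ := zorn_le_nonempty₀
    {J : Ideal D | IsQuasiIdeal s.finiteType J ∧ J ≠ ⊤} (fun c hc hchain J hJ => by
      have hdir := hchain.directedOn
      have hmem {a : D} : a ∈ sSup c ↔ ∃ I ∈ c, a ∈ I :=
        Submodule.mem_sSup_of_directed ⟨J, hJ⟩ hdir
      have h0 : sSup c ≠ ⊥ := fun h => (hc hJ).1.1 (le_bot_iff.1 (h ▸ le_sSup hJ))
      refine ⟨sSup c, ⟨⟨h0, le_antisymm ?_ (s.finiteType.le_idealClosure _ h0)⟩, ?_⟩,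
        fun I hI => le_sSup hI⟩
      · rintro a ⟨F, hF, hFE, ha⟩
        -- This is where finite type matters: finitely many generators taken from the union of a
        -- chain already lie in one member of it.
        obtain ⟨I, hI, hFI⟩ : ∃ I ∈ c, F.1 ≤ Submodule.map (Algebra.linearMap D K) I := by
          obtain ⟨S, hS⟩ := hF
          have hSc : ∀ T : Finset K, T ⊆ S →
              ∃ I ∈ c, ∀ x ∈ T, x ∈ Submodule.map (Algebra.linearMap D K) I := by
            classical
            intro T
            induction T using Finset.induction_on with
            | empty => exact fun _ => ⟨J, hJ, by simp⟩
            | insert x T _ ih =>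
              intro hT
              obtain ⟨I, hI, h1⟩ := ih fun y hy => hT (Finset.mem_insert_of_mem hy)
              obtain ⟨b, hb, rfl⟩ := hFE (hS ▸ Submodule.subset_span
                (hT (Finset.mem_insert_self x T)))
              obtain ⟨I', hI', hb'⟩ := hmem.1 hb
              obtain ⟨L, hL, h2, h3⟩ := hdir I hI I' hI'
              refine ⟨L, hL, fun y hy => ?_⟩
              rcases Finset.mem_insert.1 hy with rfl | hy
              · exact Submodule.mem_map_of_mem (h3 hb')
              · exact Submodule.map_mono h2 (h1 y hy)
          obtain ⟨I, hI, h⟩ := hSc S subset_rfl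
          exact ⟨I, hI, by rw [← hS]; exact Submodule.span_le.2 h⟩
        obtain ⟨hI0, hI1⟩ := (hc hI).1
        refine hmem.2 ⟨I, hI, ?_⟩
        rw [← hI1]
        exact ⟨F, hF, hFI, ha⟩
      · rw [Ne, Ideal.eq_top_iff_one, hmem]
        rintro ⟨I, hI, h⟩
        exact (hc hI).2 ((Ideal.eq_top_iff_one I).2 h)) I ⟨hI, hI1⟩
  exact ⟨⟨P, isPrime_of_maximal_isQuasiIdeal hP⟩, hP, hIP⟩

/-- The maximal quasi-ideals of two operations coincide when one operation is smaller than the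
other and both have the same ideals with trivial closure. -/
theorem quasiMax_eq_of_le {s s' : SemistarOp D K}
    (hs : ∀ E : NonzeroSubmodule D K, (s.toFun E).1 ≤ (s'.toFun E).1)
    (h1 : ∀ (I : Ideal D) (hI : I ≠ ⊥), (1 : K) ∈ (s'.toFun (idealToSubmodule I hI)).1 →
      (1 : K) ∈ (s.toFun (idealToSubmodule I hI)).1) : quasiMax s = quasiMax s' := by
  -- The larger operation has fewer quasi-ideals, but they are cofinal among the proper ones of the
  -- smaller: the `s'`-closure of a proper quasi-`s`-ideal stays proper by `h1`. Both families thus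
  -- have the same maximal elements.
  have hex {I : Ideal D} (hI : IsQuasiIdeal s I ∧ I ≠ ⊤) :
      ∃ J, (IsQuasiIdeal s' J ∧ J ≠ ⊤) ∧ I ≤ J :=
    ⟨s'.idealClosure I hI.1.1, ⟨s'.isQuasiIdeal_idealClosure _ _,
      SemistarOp.idealClosure_ne_top_iff.2 fun h => hI.1.one_notMem hI.2 (h1 _ _ h)⟩,
      s'.le_idealClosure _ _⟩
  have hsub {I : Ideal D} (hI : IsQuasiIdeal s' I ∧ I ≠ ⊤) : IsQuasiIdeal s I ∧ I ≠ ⊤ :=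
    ⟨isQuasiIdeal_of_le hs hI.1, hI.2⟩
  ext P
  constructor
  · rintro ⟨hP, hmax⟩
    obtain ⟨J, hJ, hPJ⟩ := hex hP
    have e : P.asIdeal = J := le_antisymm hPJ (hmax (hsub hJ) hPJ)
    exact ⟨e ▸ hJ, fun I hI hPI => hmax (hsub hI) hPI⟩
  · rintro ⟨hP, hmax⟩
    refine ⟨hsub hP, fun I hI hPI => ?_⟩
    obtain ⟨J, hJ, hIJ⟩ := hex hI
    exact hIJ.trans (hmax hJ (hPI.trans hIJ))

theorem mem_localizationAt {P : PrimeSpectrum D} {y : K} :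
    y ∈ (localizationAt P : Submodule D K) ↔
      ∃ a s : D, s ∉ P.asIdeal ∧ y = algebraMap D K a * (algebraMap D K s)⁻¹ := by
  constructor
  · rintro ⟨a, s, hs, e⟩
    exact ⟨a, s, hs, e⟩
  · rintro ⟨a, s, hs, e⟩
    exact ⟨a, s, hs, e⟩

/-- A finite sum of fractions has a common denominator, which avoids `P` because `P` is prime. -/
theorem mem_mul_localizationAt {P : PrimeSpectrum D} {E : Submodule D K} {y : K} :
    y ∈ E * localizationAt P ↔ ∃ s ∉ P.asIdeal, s • y ∈ E := by
  constructor
  · intro h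
    induction h using Submodule.mul_induction_on' with
    | mem_mul_mem e he l hl =>
      obtain ⟨a, s, hs, rfl⟩ := mem_localizationAt.1 hl
      have hs0 : algebraMap D K s ≠ 0 := fun h =>
        hs (by rw [(map_eq_zero_iff _ (IsFractionRing.injective D K)).1 h]; exact zero_mem _)
      refine ⟨s, hs, ?_⟩
      have : s • (e * (algebraMap D K a * (algebraMap D K s)⁻¹)) = a • e := by
        rw [Algebra.smul_def, Algebra.smul_def]
        field_simp
      rw [this]
      exact E.smul_mem _ he
    | add x _ y _ hx hy =>
      obtain ⟨s, hs, hx⟩ := hx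
      obtain ⟨t, ht, hy⟩ := hy
      refine ⟨s * t, P.isPrime.mul_notMem hs ht, ?_⟩
      rw [smul_add]
      refine add_mem ?_ ?_
      · rw [mul_comm, mul_smul]
        exact E.smul_mem _ hx
      · rw [mul_smul]
        exact E.smul_mem _ hy
  · rintro ⟨s, hs, h⟩
    have hs0 : algebraMap D K s ≠ 0 := fun h =>
      hs (by rw [(map_eq_zero_iff _ (IsFractionRing.injective D K)).1 h]; exact zero_mem _)
    have := Submodule.mul_mem_mul h (mem_localizationAt.2 ⟨1, s, hs, rfl⟩)
    rwa [Algebra.smul_def, map_one, one_mul, mul_comm _ y, mul_inv_cancel_right₀ hs0] at this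

theorem mem_stableFiniteType {s : SemistarOp D K} {E : NonzeroSubmodule D K} {y : K} :
    y ∈ (s.stableFiniteType.toFun E).1 ↔
      ∀ P ∈ quasiMax s.finiteType, ∃ u ∉ P.asIdeal, u • y ∈ E.1 := by
  change y ∈ ⨅ P ∈ quasiMax s.finiteType, E.1 * (localizationAt P : Submodule D K) ↔ _
  simp only [Submodule.mem_iInf, mem_mul_localizationAt]

/-- If `y` lies in every `E D_P`, the ideal `I = (E : y) ∩ D` is contained in no maximal
quasi-`⋆_f`-ideal, so `1 ∈ I^{⋆_f}`. Hence `y ∈ (yI)^{⋆_f} ⊆ E^{⋆_f}`. -/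
theorem stableFiniteType_le_finiteType (s : SemistarOp D K) (E : NonzeroSubmodule D K) :
    (s.stableFiniteType.toFun E).1 ≤ (s.finiteType.toFun E).1 := by
  intro y hy
  rcases eq_or_ne y 0 with rfl | hy0
  · exact zero_mem _
  let I : Ideal D := Submodule.comap (LinearMap.toSpanSingleton D K y) E.1
  have hmem {a : D} : a ∈ I ↔ a • y ∈ E.1 := Iff.rfl
  -- Writing `y / e = a / b` for a nonzero `e ∈ E`, the denominator `b` lies in `I`.
  have hI : I ≠ ⊥ := by
    obtain ⟨e, he, he0⟩ := Submodule.exists_mem_ne_zero_of_ne_bot E.2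
    obtain ⟨a, b, hb, h⟩ := IsFractionRing.div_surjective D (y / e)
    have hb0 : algebraMap D K b ≠ 0 := IsFractionRing.to_map_ne_zero_of_mem_nonZeroDivisors hb
    refine (Submodule.ne_bot_iff _).2 ⟨b, hmem.2 ?_, nonZeroDivisors.ne_zero hb⟩
    have : b • y = a • e := by
      rw [div_eq_div_iff hb0 he0] at h
      rw [Algebra.smul_def, Algebra.smul_def, h, mul_comm]
    rw [this]
    exact E.1.smul_mem _ he
  have h1 : (1 : K) ∈ (s.finiteType.toFun (idealToSubmodule I hI)).1 := by
    by_contra hn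
    obtain ⟨P, hP, hIP⟩ := exists_quasiMax_ge s (s.finiteType.isQuasiIdeal_idealClosure I hI)
      (SemistarOp.idealClosure_ne_top_iff.2 hn)
    obtain ⟨u, hu, huy⟩ := mem_stableFiniteType.1 hy P hP
    exact hu (hIP (s.finiteType.le_idealClosure I hI (hmem.2 huy)))
  have h2 := s.finiteType.mul_mem_toFun_scale hy0 h1
  rw [mul_one] at h2
  refine s.finiteType.mono _ _ (fun x hx => ?_) h2
  obtain ⟨a, ha, e⟩ := (mem_smul_iff hy0 _ _).1 hx
  have := hmem.1 ha
  rwa [Algebra.smul_def, ← Algebra.linearMap_apply, e, mul_comm, mul_inv_cancel_left₀ hy0] at this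

/-- A finitely generated submodule is fractional, so the default value `K` does not occur. -/
theorem mem_vOp_of_fg {E : NonzeroSubmodule D K} (hE : E.1.FG) {y : K} :
    y ∈ ((vOp D K).toFun E).1 ↔
      ∀ x : K, (∀ e ∈ E.1, x * e ∈ (1 : Submodule D K)) → y * x ∈ (1 : Submodule D K) := by
  change y ∈ vSubmodule D K E ↔ _
  rw [vSubmodule, if_pos (FractionalIdeal.isFractional_of_fg hE)]
  simp only [Submodule.mem_div_iff_forall_mul_mem]

/-- A finitely generated submodule of `K` has a common denominator. -/
theorem exists_mul_mem_one_of_fg {E : Submodule D K} (hE : E.FG) :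
    ∃ d : D, d ≠ 0 ∧ ∀ e ∈ E, algebraMap D K d * e ∈ (1 : Submodule D K) := by
  obtain ⟨d, hd, h⟩ := FractionalIdeal.isFractional_of_fg (S := nonZeroDivisors D) hE
  refine ⟨d, nonZeroDivisors.ne_zero hd, fun e he => ?_⟩
  obtain ⟨c, hc⟩ := h e he
  exact Submodule.mem_one.2 ⟨c, by rw [hc, Algebra.smul_def]⟩

end Ideals

/-! ### Nakayama's lemma and a local form of Gauss's lemma -/

section LocalGauss

variable {D K : Type*} [CommRing D] [Field K] [Algebra D K]

/-- A form of Nakayama's lemma for the localization at a prime ideal. -/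
theorem exists_notMem_smul_mem_of_smul_mem_sup {P : Ideal D} (hP : P.IsPrime)
    {L N : Submodule D K} (hN : N.FG) {s : D} (hs : s ∉ P)
    (h : ∀ n ∈ N, s • n ∈ L ⊔ P • N) : ∃ u ∉ P, ∀ n ∈ N, u • n ∈ L := by
  let Q := N.map L.mkQ
  have : Module.Finite D Q := Module.Finite.iff_fg.2 (hN.map _)
  -- On the image `Q` of `N` modulo `L`, the hypothesis says `sQ ⊆ PQ`, so the Cayley–Hamilton
  -- theorem applies to multiplication by `s`.
  have hrange : LinearMap.range (algebraMap D (Module.End D Q) s) ≤ P • ⊤ := by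
    rintro _ ⟨⟨_, n, hn, rfl⟩, rfl⟩
    have h1 : (P • (⊤ : Submodule D Q)).map Q.subtype = P • Q := by
      rw [Submodule.map_smul'', Submodule.map_top, Submodule.range_subtype]
    have h2 : L.mkQ (s • n) ∈ P • Q := by
      have := Submodule.mem_map_of_mem (f := L.mkQ) (h n hn)
      rwa [Submodule.map_sup, Submodule.map_smul'', L.mkQ_map_self, bot_sup_eq] at this
    rw [← h1] at h2
    obtain ⟨w, hw, e⟩ := h2
    have e' : w = algebraMap D (Module.End D Q) s ⟨L.mkQ n, n, hn, rfl⟩ :=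
      Subtype.ext (e.trans (map_smul L.mkQ s n))
    exact e' ▸ hw
  obtain ⟨p, hp, -, hpc, hp0⟩ :=
    LinearMap.exists_monic_and_natDegree_eq_and_coeff_mem_pow_and_aeval_eq_zero D
      (algebraMap D (Module.End D Q) s) P hrange
  -- The polynomial `p` is monic with lower coefficients in `P`, so `p(s)` is congruent to a power
  -- of `s` modulo `P`, while `p(s)` kills `Q`.
  refine ⟨p.eval s, fun hmem => hs ?_, fun n hn => ?_⟩
  · refine hP.mem_of_pow_mem p.natDegree ?_
    rw [eval_eq_sum_range, Finset.sum_range_succ, hp.coeff_natDegree, one_mul] at hmem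
    refine (P.add_mem_iff_right (sum_mem fun i hi => P.mul_mem_right _ ?_)).1 hmem
    exact Ideal.pow_le_self (by have := Finset.mem_range.1 hi; omega) (hpc i)
  · rw [aeval_algebraMap_apply] at hp0
    have := congrArg Subtype.val (LinearMap.congr_fun hp0 ⟨L.mkQ n, n, hn, rfl⟩)
    exact (Submodule.Quotient.mk_eq_zero L).1 ((map_smul L.mkQ _ n).trans this)

theorem polyContent_fg (f : K[X]) : (polyContent D f).FG := by
  refine Submodule.fg_span
    (((Set.finite_Iic (f.natDegree + 1)).image f.coeff).subset ?_)
  rintro _ ⟨n, rfl⟩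
  rcases le_or_gt n (f.natDegree + 1) with hn | hn
  · exact ⟨n, hn, rfl⟩
  -- The index just above the degree stands for all the vanishing coefficients.
  · refine ⟨f.natDegree + 1, Set.self_mem_Iic, ?_⟩
    rw [coeff_eq_zero_of_natDegree_lt (by omega), coeff_eq_zero_of_natDegree_lt (by omega)]

/-- A local form of Gauss's lemma: if `c(g) D_P = D_P` then `c(f) D_P ⊆ c(gf) D_P`. -/
theorem exists_notMem_smul_coeff_mem {P : Ideal D} (hP : P.IsPrime) {g : D[X]}
    (hg : ∃ n, g.coeff n ∉ P) {f : K[X]} {L : Submodule D K}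
    (h : ∀ n, (g.map (algebraMap D K) * f).coeff n ∈ L) :
    ∃ u ∉ P, ∀ n, u • f.coeff n ∈ L := by
  classical
  have hbdd : ∀ n, g.coeff n ∉ P → n ≤ g.natDegree := fun n hn => by
    by_contra! hlt
    exact hn (by rw [coeff_eq_zero_of_natDegree_lt hlt]; exact zero_mem _)
  obtain ⟨n₀, hn₀⟩ := hg
  -- The last index at which `g` has a coefficient outside `P`.
  set j := Nat.findGreatest (fun n => g.coeff n ∉ P) g.natDegree
  have hjP : g.coeff j ∉ P :=
    Nat.findGreatest_spec (P := fun n => g.coeff n ∉ P) (hbdd n₀ hn₀) hn₀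
  have hgt : ∀ n, j < n → g.coeff n ∈ P := fun n hn => by
    by_contra hnP
    exact absurd (Nat.le_findGreatest (hbdd n hnP) hnP) (not_le.2 hn)
  have hmem (n : ℕ) : f.coeff n ∈ polyContent D f := Submodule.subset_span ⟨n, rfl⟩
  -- Downward induction on `k`, with `m` as counter. In the coefficient of `gf` at `j + k`, the
  -- terms other than `g_j f_k` have either `g_a ∈ P` (for `a > j`) or `f_b` with `b > k`, which the
  -- induction hypothesis covers. One exponent, `deg f + 1`, then serves all `k`, and Nakayama's
  -- lemma removes the summand `P c(f)`.
  have key : ∀ m k, f.natDegree < k + m →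
      g.coeff j ^ m • f.coeff k ∈ L ⊔ P • polyContent D f := by
    intro m
    induction m with
    | zero =>
      intro k hk
      rw [coeff_eq_zero_of_natDegree_lt (p := f) (by simpa using hk), smul_zero]
      exact zero_mem _
    | succ m ih =>
      intro k hk
      have e := coeff_mul (g.map (algebraMap D K)) f (j + k)
      rw [← Finset.add_sum_erase _ _
        (Finset.HasAntidiagonal.mem_antidiagonal.2 (rfl : (j, k).1 + (j, k).2 = j + k)),
        ← sub_eq_iff_eq_add] at e
      simp only [coeff_map, ← Algebra.smul_def] at e
      rw [pow_succ, mul_smul, ← e, smul_sub]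
      refine sub_mem (Submodule.mem_sup_left (L.smul_mem _ (h _))) ?_
      rw [Finset.smul_sum]
      refine sum_mem fun ab hab => ?_
      obtain ⟨a, b⟩ := ab
      simp only [Finset.mem_erase, Finset.HasAntidiagonal.mem_antidiagonal, Ne,
        Prod.mk.injEq] at hab
      rcases lt_or_ge j a with hja | hja
      · exact Submodule.smul_mem _ _ (Submodule.mem_sup_right
          (Submodule.smul_mem_smul (hgt a hja) (hmem b)))
      · rw [smul_comm]
        exact Submodule.smul_mem _ _ (ih b (by omega))
  obtain ⟨u, hu, hu2⟩ := exists_notMem_smul_mem_of_smul_mem_sup hP (L := L)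
    (polyContent_fg (D := D) f)
    (s := g.coeff j ^ (f.natDegree + 1)) (fun h => hjP (hP.mem_of_pow_mem _ h)) (fun n hn => by
      induction hn using Submodule.span_induction with
      | mem x hx =>
        obtain ⟨k, rfl⟩ := hx
        exact key _ k (by omega)
      | zero => rw [smul_zero]; exact zero_mem _
      | add x y _ _ hx hy => rw [smul_add]; exact add_mem hx hy
      | smul a x _ hx => rw [smul_comm]; exact Submodule.smul_mem _ _ hx)
  exact ⟨u, hu, fun n => hu2 _ (hmem n)⟩

end LocalGauss

/-! ### Contents of submodules of `K[X]` -/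

section Poly

variable {D K : Type*} [CommRing D] [Field K] [Algebra D K]

theorem algebraMap_mem_polyExt {E : Submodule D K} {f : K[X]} :
    algebraMap K[X] (RatFunc K) f ∈ (polyExt E : Submodule D[X] (RatFunc K)) ↔
      ∀ n, f.coeff n ∈ E := by
  constructor
  · rintro ⟨g, hg, e⟩
    rwa [← RatFunc.algebraMap_injective K e]
  · exact fun h => ⟨f, h, rfl⟩

theorem polyExt_one : polyExt (1 : Submodule D K) = 1 := by
  ext a
  rw [Submodule.mem_one]
  constructor
  · rintro ⟨f, hf, rfl⟩
    simp only [Submodule.mem_one] at hf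
    obtain ⟨g, hg⟩ := (mem_lifts f).1 ((lifts_iff_coeff_lifts f).2 hf)
    exact ⟨g, by rw [algebraMap_polynomial_ratFunc, hg]⟩
  · rintro ⟨g, rfl⟩
    exact algebraMap_mem_polyExt.2 fun n => Submodule.mem_one.2 ⟨_, (coeff_map _ n).symm⟩

theorem algebraMap_mem_one {f : K[X]} :
    algebraMap K[X] (RatFunc K) f ∈ (1 : Submodule D[X] (RatFunc K)) ↔
      ∀ n, f.coeff n ∈ (1 : Submodule D K) := by
  rw [← polyExt_one, algebraMap_mem_polyExt]

theorem exists_eq_of_mem_one {a : RatFunc K} (ha : a ∈ (1 : Submodule D[X] (RatFunc K))) :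
    ∃ f : K[X], algebraMap K[X] (RatFunc K) f = a := by
  obtain ⟨g, rfl⟩ := Submodule.mem_one.1 ha
  exact ⟨_, rfl⟩

/-- The content of a finitely generated submodule of `K[X]` is finitely generated. -/
theorem content_fg {A : Submodule D[X] (RatFunc K)} (hA : A.FG)
    (h : ∀ a ∈ A, ∃ f : K[X], algebraMap K[X] (RatFunc K) f = a) : (content A).FG := by
  obtain ⟨S, rfl⟩ := hA
  choose! φ hφ using h
  have e : content (Submodule.span D[X] (S : Set (RatFunc K))) =
      ⨆ a ∈ S, polyContent D (φ a) := by
    refine le_antisymm (content_le fun f hf => ?_) (iSup₂_le fun a ha => ?_)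
    -- Since `E[X]` is a `D[X]`-submodule, it is enough to check the generators.
    · rw [← algebraMap_mem_polyExt]
      refine Submodule.span_le.2 (fun a ha => ?_) hf
      rw [SetLike.mem_coe, ← hφ a (Submodule.subset_span ha), algebraMap_mem_polyExt]
      exact fun n => (le_iSup₂_of_le (f := fun a (_ : a ∈ S) => polyContent D (φ a)) a ha le_rfl)
        (Submodule.subset_span ⟨n, rfl⟩)
    · refine Submodule.span_le.2 ?_
      rintro _ ⟨n, rfl⟩
      refine coeff_mem_content ?_ n
      rw [hφ a (Submodule.subset_span ha)]
      exact Submodule.subset_span ha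
  rw [e]
  exact Submodule.fg_biSup S _ fun a _ => polyContent_fg _

theorem exists_eq_of_mem_scale {A : NonzeroSubmodule D[X] (RatFunc K)} {z : RatFunc K}
    (hz : z ≠ 0) (hzA : z ∈ polyColon A.1) {a : RatFunc K} (ha : a ∈ (A.scale z hz).1) :
    ∃ f : K[X], algebraMap K[X] (RatFunc K) f = a := by
  obtain ⟨f, hf⟩ := hzA _ ((mem_smul_iff hz _ _).1 ha)
  exact ⟨f, by rw [hf, mul_inv_cancel_left₀ hz]⟩

theorem scaledContent_fg {A : NonzeroSubmodule D[X] (RatFunc K)} (hA : A.1.FG) {z : RatFunc K}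
    (hz : z ≠ 0) (hzA : z ∈ polyColon A.1) : (scaledContent A z hz hzA).1.FG :=
  content_fg (hA.map _) fun _ => exists_eq_of_mem_scale hz hzA

theorem coeff_mem_scaledContent {A : NonzeroSubmodule D[X] (RatFunc K)} {z : RatFunc K}
    (hz : z ≠ 0) (hzA : z ∈ polyColon A.1) {a : RatFunc K} (ha : a ∈ A.1) {f : K[X]}
    (hf : algebraMap K[X] (RatFunc K) f = z * a) (n : ℕ) :
    f.coeff n ∈ (scaledContent A z hz hzA).1 :=
  coeff_mem_content ((mem_smul_iff hz _ _).2 (by rwa [hf, inv_mul_cancel_left₀ hz])) n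

theorem mul_mul_mem_one_of_content {A : NonzeroSubmodule D[X] (RatFunc K)} {z : RatFunc K}
    (hz : z ≠ 0) (hzA : z ∈ polyColon A.1) {x : K}
    (hx : ∀ e ∈ (scaledContent A z hz hzA).1, x * e ∈ (1 : Submodule D K))
    {a : RatFunc K} (ha : a ∈ A.1) :
    algebraMap K[X] (RatFunc K) (C x) * z * a ∈ (1 : Submodule D[X] (RatFunc K)) := by
  obtain ⟨f, hf⟩ := hzA a ha
  rw [mul_assoc, ← hf, ← map_mul, algebraMap_mem_one]
  intro n
  rw [coeff_C_mul]
  exact hx _ (coeff_mem_scaledContent hz hzA ha hf n)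

/-- For finitely generated `A`, only finitely generated contents `c(zA)` enter the definition of
`▲`. -/
theorem blackTriangle_mono_of_fg {s s' : SemistarOp D K}
    (h : ∀ E : NonzeroSubmodule D K, E.1.FG → (s.toFun E).1 ≤ (s'.toFun E).1)
    (A : NonzeroSubmodule D[X] (RatFunc K)) (hA : A.1.FG) :
    (s.blackTriangle.toFun A).1 ≤ (s'.blackTriangle.toFun A).1 := by
  intro y hy
  refine (mem_blackTriangleSubmodule s' A y).2 fun z hz hzA => ?_
  exact polyExt_mono (h _ (scaledContent_fg hA hz hzA))
    ((mem_blackTriangleSubmodule s A y).1 hy z hz hzA)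

/-! ### Comparison with the operations `v`, `t` and `w` of `D[X]` -/

variable [IsFractionRing D K]

theorem exists_eq_of_C_mul_eq {d : D} (hd : d ≠ 0) {f : K[X]} {y : RatFunc K}
    (h : algebraMap K[X] (RatFunc K) (C (algebraMap D K d)) * y = algebraMap K[X] (RatFunc K) f) :
    ∃ g : K[X], algebraMap K[X] (RatFunc K) g = y := by
  have hd0 : algebraMap D K d ≠ 0 := fun h0 =>
    hd ((map_eq_zero_iff _ (IsFractionRing.injective D K)).1 h0)
  refine ⟨C (algebraMap D K d)⁻¹ * f, ?_⟩
  rw [map_mul, ← h, ← mul_assoc, ← map_mul, ← C_mul, inv_mul_cancel₀ hd0, C_1, map_one, one_mul]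

variable [IsDomain D]

/-- Both sides are tested by multipliers: elements of `(D[X] : A)` on the right, and on the left
pairs of a `z` in `(K[X] : A)` and an `x` in `(D : c(zA))`. Such a pair gives the multiplier `xz`,
and a nonzero multiplier `x` on the right gives the pair `z = x` with constant `1`. -/
theorem blackTriangle_vOp_of_fg (A : NonzeroSubmodule D[X] (RatFunc K)) (hA : A.1.FG) :
    ((vOp D K).blackTriangle.toFun A).1 = ((vOp D[X] (RatFunc K)).toFun A).1 := by
  refine le_antisymm (fun y hy => (mem_vOp_of_fg hA).2 fun x hx => ?_) (fun y hy =>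
    (mem_blackTriangleSubmodule _ A y).2 fun z hz hzA => ?_)
  · rcases eq_or_ne x 0 with rfl | hx0
    · rw [mul_zero]; exact zero_mem _
    have hxA : x ∈ polyColon A.1 := fun a ha => exists_eq_of_mem_one (hx a ha)
    obtain ⟨f, hf, e⟩ := (mem_blackTriangleSubmodule _ A y).1 hy x hx0 hxA
    rw [mul_comm, ← e, algebraMap_mem_one]
    intro n
    have := (mem_vOp_of_fg (scaledContent_fg hA hx0 hxA)).1 (hf n) 1 (fun c hc => by
      rw [one_mul]
      refine content_le (fun g hg m => ?_) hc
      have h1 := hx _ ((mem_smul_iff hx0 _ _).1 hg)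
      rw [mul_inv_cancel_left₀ hx0] at h1
      exact algebraMap_mem_one.1 h1 m)
    rwa [mul_one] at this
  · have hfg := scaledContent_fg hA hz hzA
    have hv (x : K) (hx : ∀ e ∈ (scaledContent A z hz hzA).1, x * e ∈ (1 : Submodule D K)) :
        algebraMap K[X] (RatFunc K) (C x) * (z * y) ∈ (1 : Submodule D[X] (RatFunc K)) := by
      have := (mem_vOp_of_fg hA).1 hy _ fun a ha => mul_mul_mem_one_of_content hz hzA hx ha
      rwa [mul_comm, mul_assoc] at this
    -- A common denominator `d` of `c(zA)` is used first, only to see that `zy` is a polynomial over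
    -- `K`; its coefficients can then be tested one by one.
    obtain ⟨d, hd, hd1⟩ := exists_mul_mem_one_of_fg hfg
    obtain ⟨p, hp⟩ := exists_eq_of_mem_one (hv _ hd1)
    obtain ⟨f, hf⟩ := exists_eq_of_C_mul_eq hd hp.symm
    rw [← hf, algebraMap_mem_polyExt]
    refine fun n => (mem_vOp_of_fg hfg).2 fun x hx => ?_
    have := hv x hx
    rw [← hf, ← map_mul, algebraMap_mem_one] at this
    have := this n
    rwa [coeff_C_mul, mul_comm] at this

theorem blackTriangle_vOp_finiteType :
    (vOp D K).blackTriangle.finiteType = tOp D[X] (RatFunc K) :=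
  SemistarOp.finiteType_congr blackTriangle_vOp_of_fg

theorem blackTriangle_tOp_finiteType :
    (tOp D K).blackTriangle.finiteType = tOp D[X] (RatFunc K) := by
  rw [← blackTriangle_vOp_finiteType]
  have h (E : NonzeroSubmodule D K) (hE : E.1.FG) :
      ((tOp D K).toFun E).1 = ((vOp D K).toFun E).1 :=
    congrArg Subtype.val ((vOp D K).finiteType_of_fg hE)
  exact SemistarOp.finiteType_congr fun A hA => le_antisymm
    (blackTriangle_mono_of_fg (fun E hE => (h E hE).le) A hA)
    (blackTriangle_mono_of_fg (fun E hE => (h E hE).ge) A hA)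

/-- A finitely generated ideal of `D[X]` with trivial `v`-closure is not contained in `P[X]`,
for any maximal `t`-ideal `P` of `D`. -/
theorem exists_coeff_notMem_of_one_mem_vOp {J : NonzeroSubmodule D[X] (RatFunc K)} (hJ : J.1.FG)
    (hJ1 : J.1 ≤ 1) (h1 : 1 ∈ ((vOp D[X] (RatFunc K)).toFun J).1) {P : PrimeSpectrum D}
    (hP : P ∈ quasiMax (vOp D K).finiteType) :
    ∃ g : D[X], algebraMap D[X] (RatFunc K) g ∈ J.1 ∧ ∃ n, g.coeff n ∉ P.asIdeal := by
  by_contra! hc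
  have hone : (1 : RatFunc K) ∈ polyColon J.1 := fun a ha => by
    rw [one_mul]; exact exists_eq_of_mem_one (hJ1 ha)
  have hfg := scaledContent_fg hJ one_ne_zero hone
  -- If `J ⊆ P[X]`, then `c(J)` is a finitely generated submodule of `P`, and `1 ∈ J^v` forces `1 ∈
  -- c(J)^v`. So `1 ∈ P^t`, although `P` is a proper quasi-`t`-ideal.
  refine hP.1.1.one_notMem hP.1.2 ⟨scaledContent J 1 one_ne_zero hone, hfg,
    content_le fun f hf n => ?_, (mem_vOp_of_fg hfg).2 fun x hx => ?_⟩
  · have hfJ := (mem_smul_iff (one_ne_zero (α := RatFunc K)) _ _).1 hf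
    rw [inv_one, one_mul] at hfJ
    obtain ⟨g, hg⟩ := Submodule.mem_one.1 (hJ1 hfJ)
    have e : g.map (algebraMap D K) = f := RatFunc.algebraMap_injective K hg
    rw [← e, coeff_map, algebraMap_mem_idealToSubmodule]
    exact hc g (hg ▸ hfJ) n
  · have := (mem_vOp_of_fg hJ).1 h1 _ fun a ha =>
      mul_mul_mem_one_of_content (one_ne_zero (α := RatFunc K)) hone hx ha
    rw [one_mul, mul_one, algebraMap_mem_one] at this
    simpa using this 0

theorem one_mem_blackTriangle_wOp {J : NonzeroSubmodule D[X] (RatFunc K)} (hJ : J.1.FG)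
    (hJ1 : J.1 ≤ 1) (h1 : 1 ∈ ((vOp D[X] (RatFunc K)).toFun J).1) :
    1 ∈ ((wOp D K).blackTriangle.toFun J).1 := by
  refine (mem_blackTriangleSubmodule _ J 1).2 fun z hz hzJ => ?_
  -- Since `1 ∈ J^v = J^{▲^v}`, the product `z · 1` is a polynomial `f`, so `gf` lies in `zJ` for
  -- every `g ∈ J`.
  obtain ⟨f, -, hf⟩ := (mem_blackTriangleSubmodule _ J 1).1
    ((blackTriangle_vOp_of_fg J hJ).ge h1) z hz hzJ
  rw [← hf, algebraMap_mem_polyExt]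
  refine fun n => mem_stableFiniteType.2 fun P hP => ?_
  obtain ⟨g, hgJ, hg⟩ := exists_coeff_notMem_of_one_mem_vOp hJ hJ1 h1 hP
  obtain ⟨u, hu, h⟩ := exists_notMem_smul_coeff_mem P.isPrime hg
    (f := f) (L := (scaledContent J z hz hzJ).1) fun m =>
      coeff_mem_scaledContent hz hzJ hgJ (by
        rw [map_mul, hf, mul_one, mul_comm, algebraMap_polynomial_ratFunc]) m
  exact ⟨u, hu, h n⟩

/-- The operations `(▲^w)_f` and `t` need not be compared beyond the inequality `(▲^w)_f ≤ t` and
the ideals whose closure contains `1`; the latter reduce to finitely generated `J`. -/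
theorem quasiMax_blackTriangle_wOp_finiteType :
    quasiMax (wOp D K).blackTriangle.finiteType = quasiMax (tOp D[X] (RatFunc K)) := by
  refine quasiMax_eq_of_le (fun A => ?_) fun I hI h => ?_
  · rw [← blackTriangle_tOp_finiteType]
    exact SemistarOp.finiteType_le_of_fg (blackTriangle_mono_of_fg fun E _ =>
      stableFiniteType_le_finiteType (vOp D K) E) A
  · obtain ⟨J, hJ, hJI, h1⟩ := h
    refine ⟨J, hJ, hJI, one_mem_blackTriangle_wOp hJ (hJI.trans ?_) h1⟩
    rintro _ ⟨a, -, rfl⟩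
    exact Submodule.mem_one.2 ⟨a, rfl⟩

theorem blackTriangle_vOp_stableFiniteType :
    (vOp D K).blackTriangle.stableFiniteType = wOp D[X] (RatFunc K) := by
  rw [SemistarOp.stableFiniteType, blackTriangle_vOp_finiteType]
  rfl

theorem blackTriangle_wOp_stableFiniteType :
    (wOp D K).blackTriangle.stableFiniteType = wOp D[X] (RatFunc K) := by
  rw [SemistarOp.stableFiniteType, quasiMax_blackTriangle_wOp_finiteType]
  rfl

end Poly

end Semistar

theorem mainTheorem6 (D K : Type*) [CommRing D] [IsDomain D] [Field K] [Algebra D K]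
    [IsFractionRing D K] :
    ((Semistar.vOp D K).blackTriangle.finiteType = Semistar.tOp (Polynomial D) (RatFunc K) ∧
      (Semistar.tOp D K).blackTriangle.finiteType = Semistar.tOp (Polynomial D) (RatFunc K)) ∧
    ((Semistar.vOp D K).blackTriangle.stableFiniteType =
        Semistar.wOp (Polynomial D) (RatFunc K) ∧
      (Semistar.wOp D K).blackTriangle.stableFiniteType =
        Semistar.wOp (Polynomial D) (RatFunc K)) :=
  ⟨⟨Semistar.blackTriangle_vOp_finiteType, Semistar.blackTriangle_tOp_finiteType⟩,
    Semistar.blackTriangle_vOp_stableFiniteType, Semistar.blackTriangle_wOp_stableFiniteType⟩
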